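/- Let $\mathcal{M}$ be a smooth finite-dimensional Riemannian manifold (possibly with boundary) with Levi-Civita connection $\nabla$, and let $f:\mathcal{M}\to\mathbb{R}$ be a smooth function. Let $\mathrm{Hess}_f := \nabla\nabla f$ be its Hessian tensor, that is, $\mathrm{Hess}_f(X,Y) = X(Yf) - (\nabla_X Y)f$ for vector fields $X,Y$. A geodesic is a $C^2$ (equivalently, smooth) curve $\gamma: J\to\mathcal{M}$ on an interval $J\subseteq\mathbb{R}$ whose velocity satisfies $\frac{D\dot\gamma}{dt}=0$ on $J$, where $\frac{D}{dt}$ is the covariant derivative along $\gamma$ induced by $\nabla$. Then $\mathrm{Hess}_f = 0$ on $\mathcal{M}$ if and only if for every interval $J$ and every geodesic $\gamma: J\to\mathcal{M}$ the function $t\mapsto f(\gamma(t))$ is affine on $J$, i.e. there are $a,b\in\mathbb{R}$ with $f(\gamma(t)) = at+b$ for all $t\in J$. -/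

import Mathlib

open Bundle FiberBundle VectorField
open scoped Manifold ContDiff Bundle

noncomputable section

namespace RiemannianHessian


section LeviCivita

variable {E : Type*} [NormedAddCommGroup E] [NormedSpace ℝ E] [FiniteDimensional ℝ E]
  {H : Type*} [TopologicalSpace H] {I : ModelWithCorners ℝ E H}
  {M : Type*} [TopologicalSpace M] [ChartedSpace H M] [IsManifold I ∞ M]
  [RiemannianBundle (fun x : M ↦ TangentSpace I x)]
  [IsContMDiffRiemannianBundle I ∞ E (fun x : M ↦ TangentSpace I x)]

/-- The Koszul expression for `⟨∇_X Y, Z⟩` at `x`: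
`½ (X⟨Y,Z⟩ + Y⟨X,Z⟩ - Z⟨X,Y⟩ + ⟨[X,Y],Z⟩ - ⟨[X,Z],Y⟩ - ⟨[Y,Z],X⟩)`. -/
def koszul (X Y Z : Π x : M, TangentSpace I x) (x : M) : ℝ :=
  (1 / 2 : ℝ) *
    (d% (fun y ↦ inner ℝ (Y y) (Z y)) x (X x) + d% (fun y ↦ inner ℝ (X y) (Z y)) x (Y x)
      - d% (fun y ↦ inner ℝ (X y) (Y y)) x (Z x)
      + inner ℝ (mlieBracket I X Y x) (Z x) - inner ℝ (mlieBracket I X Z x) (Y x)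
      - inner ℝ (mlieBracket I Y Z x) (X x))

variable {x : M}

theorem mdifferentiableAt_inner {Y Z : Π x : M, TangentSpace I x}
    (hY : MDiffAt (T% Y) x) (hZ : MDiffAt (T% Z) x) :
    MDiffAt (fun y ↦ inner ℝ (Y y) (Z y)) x :=
  MDifferentiableAt.inner_bundle (IB := I) (F := E) (E := fun x : M ↦ TangentSpace I x)
    (b := fun y ↦ y) (v := Y) (w := Z) hY hZ

theorem koszul_tensorial_left {Y Z : Π x : M, TangentSpace I x}
    (hY : MDiffAt (T% Y) x) (hZ : MDiffAt (T% Z) x) :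
    TensorialAt I E (fun X ↦ koszul X Y Z x) x where
  smul {f X} hf hX := by
    have h1 : (fun y ↦ inner ℝ ((f • X) y) (Z y)) = fun y ↦ f y * inner ℝ (X y) (Z y) := by
      ext y; simp [inner_smul_left]
    have h2 : (fun y ↦ inner ℝ ((f • X) y) (Y y)) = fun y ↦ f y * inner ℝ (X y) (Y y) := by
      ext y; simp [inner_smul_left]
    simp only [koszul, h1, h2]
    rw [mvfderiv_fun_mul hf (mdifferentiableAt_inner hX hZ),
      mvfderiv_fun_mul hf (mdifferentiableAt_inner hX hY),
      mlieBracket_smul_left hf hX, mlieBracket_smul_left hf hX]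
    simp [inner_add_left, inner_smul_left, inner_smul_right, real_inner_comm]
    ring
  add {X X'} hX hX' := by
    have h1 : (fun y ↦ inner ℝ ((X + X') y) (Z y)) =
        fun y ↦ inner ℝ (X y) (Z y) + inner ℝ (X' y) (Z y) := by
      ext y; simp [inner_add_left]
    have h2 : (fun y ↦ inner ℝ ((X + X') y) (Y y)) =
        fun y ↦ inner ℝ (X y) (Y y) + inner ℝ (X' y) (Y y) := by
      ext y; simp [inner_add_left]
    simp only [koszul, h1, h2]
    rw [mvfderiv_fun_add (mdifferentiableAt_inner hX hZ) (mdifferentiableAt_inner hX' hZ),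
      mvfderiv_fun_add (mdifferentiableAt_inner hX hY) (mdifferentiableAt_inner hX' hY),
      mlieBracket_add_left hX hX', mlieBracket_add_left hX hX']
    simp [inner_add_left, inner_add_right]
    ring

theorem koszul_tensorial_right {X Y : Π x : M, TangentSpace I x}
    (hX : MDiffAt (T% X) x) (hY : MDiffAt (T% Y) x) :
    TensorialAt I E (fun Z ↦ koszul X Y Z x) x where
  smul {f Z} hf hZ := by
    have h1 : (fun y ↦ inner ℝ (Y y) ((f • Z) y)) = fun y ↦ f y * inner ℝ (Y y) (Z y) := by
      ext y; simp [inner_smul_right]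
    have h2 : (fun y ↦ inner ℝ (X y) ((f • Z) y)) = fun y ↦ f y * inner ℝ (X y) (Z y) := by
      ext y; simp [inner_smul_right]
    simp only [koszul, h1, h2]
    rw [mvfderiv_fun_mul hf (mdifferentiableAt_inner hY hZ),
      mvfderiv_fun_mul hf (mdifferentiableAt_inner hX hZ),
      mlieBracket_smul_right hf hZ, mlieBracket_smul_right hf hZ]
    simp [inner_add_left, inner_smul_left, inner_smul_right, real_inner_comm]
    ring
  add {Z Z'} hZ hZ' := by
    have h1 : (fun y ↦ inner ℝ (Y y) ((Z + Z') y)) =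
        fun y ↦ inner ℝ (Y y) (Z y) + inner ℝ (Y y) (Z' y) := by
      ext y; simp [inner_add_right]
    have h2 : (fun y ↦ inner ℝ (X y) ((Z + Z') y)) =
        fun y ↦ inner ℝ (X y) (Z y) + inner ℝ (X y) (Z' y) := by
      ext y; simp [inner_add_right]
    simp only [koszul, h1, h2]
    rw [mvfderiv_fun_add (mdifferentiableAt_inner hY hZ) (mdifferentiableAt_inner hY hZ'),
      mvfderiv_fun_add (mdifferentiableAt_inner hX hZ) (mdifferentiableAt_inner hX hZ'),
      mlieBracket_add_right hZ hZ', mlieBracket_add_right hZ hZ']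
    simp [inner_add_left, inner_add_right]
    ring

theorem koszul_smul_middle {X Y Z : Π x : M, TangentSpace I x} {f : M → ℝ} (hf : MDiffAt f x)
    (hX : MDiffAt (T% X) x) (hY : MDiffAt (T% Y) x) (hZ : MDiffAt (T% Z) x) :
    koszul X (f • Y) Z x = f x * koszul X Y Z x + d% f x (X x) * inner ℝ (Y x) (Z x) := by
  have h1 : (fun y ↦ inner ℝ ((f • Y) y) (Z y)) = fun y ↦ f y * inner ℝ (Y y) (Z y) := by
    ext y; simp [inner_smul_left]
  have h2 : (fun y ↦ inner ℝ (X y) ((f • Y) y)) = fun y ↦ f y * inner ℝ (X y) (Y y) := by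
    ext y; simp [inner_smul_right]
  simp only [koszul, h1, h2]
  rw [mvfderiv_fun_mul hf (mdifferentiableAt_inner hY hZ),
    mvfderiv_fun_mul hf (mdifferentiableAt_inner hX hY),
    mlieBracket_smul_right hf hY, mlieBracket_smul_left hf hY]
  simp [inner_add_left, inner_smul_left, inner_smul_right, real_inner_comm]
  ring

theorem koszul_add_middle {X Y Y' Z : Π x : M, TangentSpace I x} (hX : MDiffAt (T% X) x)
    (hY : MDiffAt (T% Y) x) (hY' : MDiffAt (T% Y') x) (hZ : MDiffAt (T% Z) x) :
    koszul X (Y + Y') Z x = koszul X Y Z x + koszul X Y' Z x := by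
  have h1 : (fun y ↦ inner ℝ ((Y + Y') y) (Z y)) =
      fun y ↦ inner ℝ (Y y) (Z y) + inner ℝ (Y' y) (Z y) := by
    ext y; simp [inner_add_left]
  have h2 : (fun y ↦ inner ℝ (X y) ((Y + Y') y)) =
      fun y ↦ inner ℝ (X y) (Y y) + inner ℝ (X y) (Y' y) := by
    ext y; simp [inner_add_right]
  simp only [koszul, h1, h2]
  rw [mvfderiv_fun_add (mdifferentiableAt_inner hY hZ) (mdifferentiableAt_inner hY' hZ),
    mvfderiv_fun_add (mdifferentiableAt_inner hX hY) (mdifferentiableAt_inner hX hY'),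
    mlieBracket_add_left hY hY', mlieBracket_add_right hY hY']
  simp [inner_add_left, inner_add_right]
  ring

/-- The bilinear form `(X, Z) ↦ ⟨∇_X Y, Z⟩` at `x`, for a vector field `Y` differentiable at `x`. -/
def koszulForm (Y : Π x : M, TangentSpace I x) (x : M) (hY : MDiffAt (T% Y) x) :
    TangentSpace I x →L[ℝ] TangentSpace I x →L[ℝ] ℝ :=
  TensorialAt.mkHom₂ (I := I) (F := E) (F' := E) (fun X Z ↦ koszul X Y Z x) x
    (fun _ hZ ↦ koszul_tensorial_left hY hZ) (fun _ hX ↦ koszul_tensorial_right hX hY)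

theorem exists_riesz (K : TangentSpace I x →L[ℝ] TangentSpace I x →L[ℝ] ℝ) :
    ∃ A : TangentSpace I x →L[ℝ] TangentSpace I x, ∀ v w, inner ℝ (A v) w = K v w := by
  have : FiniteDimensional ℝ (TangentSpace I x) := inferInstanceAs (FiniteDimensional ℝ E)
  have : CompleteSpace (TangentSpace I x) := FiniteDimensional.complete ℝ _
  let A : TangentSpace I x →ₗ[ℝ] TangentSpace I x :=
    { toFun := fun v ↦ (InnerProductSpace.toDual ℝ (TangentSpace I x)).symm (K v)
      map_add' := fun v w ↦ by simp
      map_smul' := fun c v ↦ by simp }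
  exact ⟨LinearMap.toContinuousLinearMap A, fun v w ↦ by
    simp [A, InnerProductSpace.toDual_symm_apply]⟩

open Classical in
/-- `∇ Y` at `x`, determined by the Koszul formula (and `0` where `Y` is not differentiable). -/
def leviCivitaFun (Y : Π x : M, TangentSpace I x) (x : M) :
    TangentSpace I x →L[ℝ] TangentSpace I x :=
  if hY : MDiffAt (T% Y) x then (exists_riesz (koszulForm Y x hY)).choose else 0

theorem inner_leviCivitaFun {X Y Z : Π x : M, TangentSpace I x} (hX : MDiffAt (T% X) x)
    (hY : MDiffAt (T% Y) x) (hZ : MDiffAt (T% Z) x) :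
    inner ℝ (leviCivitaFun Y x (X x)) (Z x) = koszul X Y Z x := by
  rw [leviCivitaFun, dif_pos hY, (exists_riesz (koszulForm Y x hY)).choose_spec]
  exact TensorialAt.mkHom₂_apply _ _ hX hZ

theorem leviCivita_ext {A B : TangentSpace I x →L[ℝ] TangentSpace I x}
    (h : ∀ X Z : Π x : M, TangentSpace I x, MDiffAt (T% X) x → MDiffAt (T% Z) x →
      inner ℝ (A (X x)) (Z x) = inner ℝ (B (X x)) (Z x)) : A = B := by
  ext1 v
  refine ext_inner_right ℝ fun w ↦ ?_
  have := h (extend E v) (extend E w) (mdifferentiableAt_extend ..) (mdifferentiableAt_extend ..)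
  simpa using this

variable (I M) in
/-- The Levi-Civita connection of the Riemannian metric, in Mathlib's argument order:
`leviCivita I M Y x v` is `∇_v Y` at `x`. -/
def leviCivita : CovariantDerivative I E (TangentSpace I : M → Type _) where
  toFun := leviCivitaFun
  isCovariantDerivativeOnUniv :=
    { add := fun {Y Y' x} hY hY' _ ↦ leviCivita_ext fun X Z hX hZ ↦ by
        rw [inner_leviCivitaFun hX (mdifferentiableAt_add_section hY hY') hZ,
          koszul_add_middle hX hY hY' hZ, _root_.add_apply, inner_add_left,
          inner_leviCivitaFun hX hY hZ, inner_leviCivitaFun hX hY' hZ]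
      leibniz := fun {Y f x} hY hf _ ↦ leviCivita_ext fun X Z hX hZ ↦ by
        rw [inner_leviCivitaFun hX (hf.smul_section hY) hZ,
          koszul_smul_middle hf hX hY hZ]
        simp [inner_add_left, inner_smul_left, inner_leviCivitaFun hX hY hZ] }

/-- The Levi-Civita connection is torsion-free. -/
theorem leviCivita_torsion : (leviCivita I M).torsion = 0 := by
  rw [CovariantDerivative.torsion_eq_zero_iff]
  intro X Y x hX hY
  refine ext_inner_right ℝ fun w ↦ ?_
  have hZ : MDiffAt (T% (extend E w)) x := mdifferentiableAt_extend ..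
  have h1 := inner_leviCivitaFun hX hY hZ
  have h2 := inner_leviCivitaFun hY hX hZ
  simp only [extend_apply_self] at h1 h2
  rw [inner_sub_left]
  change inner ℝ (leviCivitaFun Y x (X x)) w - inner ℝ (leviCivitaFun X x (Y x)) w = _
  rw [h1, h2]
  simp only [koszul, extend_apply_self]
  rw [mlieBracket_swap_apply (V := Y) (W := X)]
  simp only [real_inner_comm, inner_neg_left]
  ring_nf

/-- The Levi-Civita connection is compatible with the metric. -/
theorem leviCivita_metric :
    CovariantDerivative.IsMetricCompatible (V := fun x : M ↦ TangentSpace I x)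
      (leviCivita I M) := by
  rw [CovariantDerivative.isMetricCompatible_iff]
  intro x X Y Z hX hY hZ
  have h1 := inner_leviCivitaFun hX hY hZ
  have h2 := inner_leviCivitaFun hX hZ hY
  change _ = inner ℝ (leviCivitaFun Y x (X x)) (Z x) + inner ℝ (Y x) (leviCivitaFun Z x (X x))
  rw [real_inner_comm _ (Y x), h1, h2]
  simp only [koszul]
  rw [mlieBracket_swap_apply (V := Z) (W := Y)]
  simp only [real_inner_comm, inner_neg_left]
  ring_nf

end LeviCivita

section Hessian

variable {E : Type*} [NormedAddCommGroup E] [NormedSpace ℝ E] [FiniteDimensional ℝ E]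
  {H : Type*} [TopologicalSpace H] {I : ModelWithCorners ℝ E H}
  {M : Type*} [TopologicalSpace M] [ChartedSpace H M] [IsManifold I ∞ M]

theorem mdifferentiableAt_mvfderiv_apply (f : C^∞⟮I, M; 𝓘(ℝ, ℝ), ℝ⟯) {x : M}
    {Y : Π x : M, TangentSpace I x} (hY : MDiffAt (T% Y) x) :
    MDiffAt (fun y ↦ d% f y (Y y)) x := by
  have h1 : MDifferentiableAt I.tangent 𝓘(ℝ, ℝ).tangent (tangentMap I 𝓘(ℝ, ℝ) f) ⟨x, Y x⟩ :=
    (f.contMDiff.contMDiff_tangentMap (m := 1) (by decide)).mdifferentiableAt (by simp)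
  have h2 := ((mdifferentiableAt_totalSpace _ _).1 (MDifferentiableAt.comp x h1 hY)).2
  have h3 : MDifferentiableAt (M' := ℝ) I 𝓘(ℝ, ℝ)
      (fun y ↦ mfderiv I 𝓘(ℝ, ℝ) f y (Y y)) x := by
    simpa [tangentMap, Function.comp_def] using h2
  exact h3

/-- `Y ↦ (X ↦ X (Y f) - (∇_X Y) f)` is tensorial in `Y`. -/
theorem hessian_tensorial (cov : CovariantDerivative I E (TangentSpace I : M → Type _))
    (f : C^∞⟮I, M; 𝓘(ℝ, ℝ), ℝ⟯) (x : M) :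
    TensorialAt I E (fun Y : Π x : M, TangentSpace I x ↦
      d% (fun y ↦ d% f y (Y y)) x - d% f x ∘L cov Y x) x where
  smul {g Y} hg hY := by
    have h1 : (fun y ↦ d% f y ((g • Y) y)) = fun y ↦ g y * d% f y (Y y) := by
      ext y; simp
    rw [h1, mvfderiv_fun_mul hg (mdifferentiableAt_mvfderiv_apply f hY),
      cov.isCovariantDerivativeOnUniv.leibniz hY hg]
    ext v
    simp
    ring
  add {Y Y'} hY hY' := by
    have h1 : (fun y ↦ d% f y ((Y + Y') y)) = fun y ↦ d% f y (Y y) + d% f y (Y' y) := by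
      ext y; simp
    rw [h1, mvfderiv_fun_add (mdifferentiableAt_mvfderiv_apply f hY)
      (mdifferentiableAt_mvfderiv_apply f hY'), cov.isCovariantDerivativeOnUniv.add hY hY']
    ext v
    simp
    ring

/-- The Hessian tensor `Hess_f = ∇ ∇ f = ∇ (df)`, i.e. `Hess_f (X, Y) = X (Y f) - (∇_X Y) f`,
as a bilinear form on each tangent space; see `hessian_apply`. -/
def hessian (cov : CovariantDerivative I E (TangentSpace I : M → Type _))
    (f : C^∞⟮I, M; 𝓘(ℝ, ℝ), ℝ⟯) (x : M) :
    TangentSpace I x →L[ℝ] TangentSpace I x →L[ℝ] ℝ :=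
  TensorialAt.mkHom₂ (I := I) (F := E) (F' := E)
    (fun X Y : Π x : M, TangentSpace I x ↦
      d% (fun y ↦ d% f y (Y y)) x (X x) - d% f x (cov Y x (X x))) x
    (fun Y _ ↦ ⟨fun _ _ ↦ by simp [mul_sub], fun _ _ ↦ by simp; ring⟩)
    (fun X _ ↦ ⟨fun hg hY ↦ congr($((hessian_tensorial cov f x).smul hg hY) (X x)),
      fun hY hY' ↦ congr($((hessian_tensorial cov f x).add hY hY') (X x))⟩)

theorem hessian_apply (cov : CovariantDerivative I E (TangentSpace I : M → Type _))
    (f : C^∞⟮I, M; 𝓘(ℝ, ℝ), ℝ⟯) {x : M} {X Y : Π x : M, TangentSpace I x}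
    (hX : MDiffAt (T% X) x) (hY : MDiffAt (T% Y) x) :
    hessian cov f x (X x) (Y x)
      = d% (fun y ↦ d% f y (Y y)) x (X x) - d% f x (cov Y x (X x)) :=
  TensorialAt.mkHom₂_apply _ _ hX hY

/-- The velocity `γ'(t)` of a curve defined on `J` (one-sided at an endpoint contained in `J`). -/
def velocity (I : ModelWithCorners ℝ E H) (γ : ℝ → M) (J : Set ℝ) (t : ℝ) : TangentSpace I (γ t) :=
  mfderivWithin 𝓘(ℝ, ℝ) I γ J t (1 : ℝ)

/-- The covariant derivative `DV/dt` of a vector field `V` along `γ : J → M`. In the local frame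
`(e_i)` of the tangent bundle given by its preferred trivialization (the coordinate frame) at `γ t`,
`DV/dt = ∑ (V^i)'(t) e_i + ∑ V^i(t) ∇_{γ'(t)} e_i`; the section `extend E (V t)` is the
constant-coefficient field `∑ V^i(t) e_i`. -/
def covDerivAlong (cov : CovariantDerivative I E (TangentSpace I : M → Type _))
    (γ : ℝ → M) (J : Set ℝ) (V : Π t : ℝ, TangentSpace I (γ t)) (t : ℝ) : TangentSpace I (γ t) :=
  letI e := trivializationAt E (TangentSpace I : M → Type _) (γ t)
  e.symmL ℝ (γ t) (derivWithin (fun s ↦ (e ⟨γ s, V s⟩).2) J t)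
    + cov (extend E (V t)) (γ t) (velocity I γ J t)

/-- A connection in the local frame given by the preferred trivialization at `x`. -/
theorem cov_eq_trivialization (cov : CovariantDerivative I E (TangentSpace I : M → Type _))
    {x : M} {Y : Π x : M, TangentSpace I x} (hY : MDiffAt (T% Y) x) (v : TangentSpace I x) :
    cov Y x v = (trivializationAt E (TangentSpace I : M → Type _) x).symmL ℝ x
        (d% (fun y ↦ (trivializationAt E (TangentSpace I : M → Type _) x ⟨y, Y y⟩).2) x v)
      + cov (extend E (Y x)) x v := by
  set e := trivializationAt E (TangentSpace I : M → Type _) x with he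
  have hx : x ∈ e.baseSet := FiberBundle.mem_baseSet_trivializationAt' x
  have hmem : ∀ᶠ y in nhds x, y ∈ e.baseSet := e.open_baseSet.mem_nhds hx
  have hd {Y : Π x : M, TangentSpace I x} (hY : MDiffAt (T% Y) x) :
      MDiffAt (fun y ↦ (e ⟨y, Y y⟩).2) x := ((mdifferentiableAt_totalSpace _ _).1 hY).2
  have hcongr {a b : M → E} (h : ∀ᶠ y in nhds x, a y = b y) : d% a x = d% b x := by
    ext1 w
    exact congr($(Filter.EventuallyEq.mfderiv_eq (I := I) (I' := 𝓘(ℝ, E)) h) w)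
  have key : TensorialAt I E (fun Y : Π x : M, TangentSpace I x ↦
      cov Y x v - e.symmL ℝ x (d% (fun y ↦ (e ⟨y, Y y⟩).2) x v)) x := by
    constructor
    · intro g Y hg hY
      have h1 : d% (fun y ↦ (e ⟨y, (g • Y) y⟩).2) x = d% (fun y ↦ g y • (e ⟨y, Y y⟩).2) x := by
        refine hcongr (hmem.mono fun y hy ↦ ?_)
        exact (e.linear ℝ hy).map_smul (g y) (Y y)
      have h2 : e.symmL ℝ x (e ⟨x, Y x⟩).2 = Y x := by
        rw [e.symmL_apply hx]; exact e.symm_apply_apply_mk hx (Y x)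
      rw [h1, mvfderiv_fun_smul hg (hd hY), cov.isCovariantDerivativeOnUniv.leibniz hY hg]
      simp only [_root_.add_apply, _root_.smul_apply, ContinuousLinearMap.smulRight_apply, map_add,
        map_smul, h2]
      module
    · intro Y Y' hY hY'
      have h1 : d% (fun y ↦ (e ⟨y, (Y + Y') y⟩).2) x
          = d% (fun y ↦ (e ⟨y, Y y⟩).2 + (e ⟨y, Y' y⟩).2) x := by
        refine hcongr (hmem.mono fun y hy ↦ ?_)
        exact (e.linear ℝ hy).map_add (Y y) (Y' y)
      rw [h1, mvfderiv_fun_add (hd hY) (hd hY'), cov.isCovariantDerivativeOnUniv.add hY hY']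
      simp
      module
  have h0 : d% (fun y ↦ (e ⟨y, extend E (Y x) y⟩).2) x = 0 := by
    rw [hcongr (b := fun _ ↦ (e ⟨x, Y x⟩).2) (hmem.mono fun y hy ↦ ?_), mvfderiv_const]
    have h := congr_arg Prod.snd (e.apply_mk_symm hy (e ⟨x, Y x⟩).2)
    exact h
  have := key.pointwise hY (mdifferentiableAt_extend ..) (extend_apply_self E (Y x)).symm
  simp only [h0] at this
  simp only [_root_.zero_apply, map_zero, sub_zero, sub_eq_iff_eq_add] at this
  rw [this, add_comm]

/-- If `V` is the restriction to `γ` of a vector field `Y`, then `DV/dt = ∇_{γ'} Y`. -/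
theorem covDerivAlong_comp (cov : CovariantDerivative I E (TangentSpace I : M → Type _))
    {γ : ℝ → M} {J : Set ℝ} {t : ℝ} (hJ : UniqueDiffWithinAt ℝ J t)
    (hγ : MDifferentiableWithinAt 𝓘(ℝ, ℝ) I γ J t)
    {Y : Π x : M, TangentSpace I x} (hY : MDiffAt (T% Y) (γ t)) :
    covDerivAlong cov γ J (fun s ↦ Y (γ s)) t = cov Y (γ t) (velocity I γ J t) := by
  rw [cov_eq_trivialization cov hY, covDerivAlong]
  have hd := ((mdifferentiableAt_totalSpace _ _).1 hY).2
  congr 2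
  have h := mfderiv_comp_mfderivWithin t hd hγ hJ.uniqueMDiffWithinAt
  rw [mfderivWithin_eq_fderivWithin] at h
  exact congr($h (1 : ℝ))

variable [RiemannianBundle (fun x : M ↦ TangentSpace I x)]
  [IsContMDiffRiemannianBundle I ∞ E (fun x : M ↦ TangentSpace I x)]

variable (I) in
/-- `γ` is a geodesic of the Levi-Civita connection on the interval `J`: a `C^2` curve (hence, by
the geodesic equation, a smooth one) with `Dγ'/dt = 0` on `J`. -/
structure IsGeodesicOn (γ : ℝ → M) (J : Set ℝ) : Prop where
  contMDiffOn : ContMDiffOn 𝓘(ℝ, ℝ) I 2 γ J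
  acceleration_eq_zero : ∀ t ∈ J,
    covDerivAlong (leviCivita I M) γ J (fun s ↦ velocity I γ J s) t = 0

end Hessian

end RiemannianHessian

end

/-
Along a geodesic the second derivative of `f` is the Hessian evaluated twice at the velocity. The
diagonal determines the Hessian because it is symmetric, which is torsion-freeness of the
connection, and at an interior point every tangent vector is the velocity of a geodesic, which is
obtained by solving the geodesic equation in a chart. At a boundary point geodesics with prescribed
velocity need not exist; there the Hessian vanishes by continuity, interior points being dense.
-/

noncomputable section

namespace RiemannianHessian

section FiniteDimensional

variable {𝕜 : Type*} [NontriviallyNormedField 𝕜] [CompleteSpace 𝕜]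
  {E : Type*} [NormedAddCommGroup E] [NormedSpace 𝕜 E]
  {F : Type*} [NormedAddCommGroup F] [NormedSpace 𝕜 F] [FiniteDimensional 𝕜 F]
  {G : Type*} [NormedAddCommGroup G] [NormedSpace 𝕜 G] {n : ℕ∞ω}

theorem contMDiffAt_clm_of_forall_apply {H : Type*} [TopologicalSpace H]
    {I : ModelWithCorners 𝕜 E H} {M : Type*} [TopologicalSpace M] [ChartedSpace H M]
    {A : M → F →L[𝕜] G} {x : M} (hA : ∀ v, CMDiffAt n (fun y ↦ A y v) x) : CMDiffAt n A x := by
  let b := Module.finBasis 𝕜 F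
  let c i : F →L[𝕜] 𝕜 := (b.coord i).toContinuousLinearMap
  have hsum : A = fun y ↦ ∑ i, ContinuousLinearMap.smulRightL 𝕜 F G (c i) (A y (b i)) := by
    ext y v
    conv_lhs => rw [← b.sum_repr v, map_sum]
    simp [c]
  rw [hsum]
  exact ContMDiffAt.sum fun i _ ↦ contMDiffAt_const.clm_apply (hA (b i))

theorem contDiffAt_uncurry_of_isLinearMap {f : E → F → G} {z : E}
    (hlin : ∀ᶠ u in nhds z, IsLinearMap 𝕜 (f u)) (hf : ∀ v, ContDiffAt 𝕜 n (fun u ↦ f u v) z)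
    (v : F) : ContDiffAt 𝕜 n (Function.uncurry f) (z, v) := by
  let b := Module.finBasis 𝕜 F
  let c i : F →L[𝕜] 𝕜 := (b.coord i).toContinuousLinearMap
  have hsum : ContDiffAt 𝕜 n (fun u : E × F ↦ ∑ i, c i u.2 • f u.1 (b i)) (z, v) :=
    ContDiffAt.sum fun i _ ↦ ((c i).contDiff.contDiffAt.comp (z, v) contDiffAt_snd).smul
      ((hf (b i)).comp (z, v) contDiffAt_fst)
  refine hsum.congr_of_eventuallyEq ?_
  filter_upwards [continuousAt_fst.eventually hlin] with u hu
  change hu.mk' (f u.1) u.2 = _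
  conv_lhs => rw [← b.sum_repr u.2, map_sum]
  simp [c]

end FiniteDimensional

section VectorBundle

variable {𝕜 : Type*} [NontriviallyNormedField 𝕜]
  {E : Type*} [NormedAddCommGroup E] [NormedSpace 𝕜 E]
  {H : Type*} [TopologicalSpace H] {I : ModelWithCorners 𝕜 E H}
  {M : Type*} [TopologicalSpace M] [ChartedSpace H M]
  {F : Type*} [NormedAddCommGroup F] [NormedSpace 𝕜 F]
  {V : M → Type*} [TopologicalSpace (TotalSpace F V)] [∀ x, AddCommGroup (V x)]
  [∀ x, Module 𝕜 (V x)] [∀ x, TopologicalSpace (V x)] [FiberBundle F V] [VectorBundle 𝕜 F V]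
  {e : Trivialization F (TotalSpace.proj : TotalSpace F V → M)} [MemTrivializationAtlas e]

theorem trivialization_symmL_apply_snd {x : M} (hx : x ∈ e.baseSet) (w : F) :
    (e ⟨x, e.symmL 𝕜 x w⟩).2 = w := by
  rw [e.symmL_apply hx, e.apply_mk_symm hx]

theorem symmL_trivialization_apply_snd {x : M} (hx : x ∈ e.baseSet) (v : V x) :
    e.symmL 𝕜 x (e ⟨x, v⟩).2 = v := by
  rw [e.symmL_apply hx, e.symm_apply_apply_mk hx]

theorem contMDiffAt_symmL_apply {n : ℕ∞ω} [ContMDiffVectorBundle n F V I] {x : M}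
    (hx : x ∈ e.baseSet) (w : F) : CMDiffAt n (T% (fun y ↦ e.symmL 𝕜 y w)) x := by
  refine (e.contMDiffAt_section_iff hx).2 <|
    (contMDiffAt_const (c := w)).congr_of_eventuallyEq ?_
  filter_upwards [e.open_baseSet.mem_nhds hx] with y hy using trivialization_symmL_apply_snd hy w

theorem mdifferentiableAt_symmL_apply [ContMDiffVectorBundle 1 F V I] {x : M}
    (hx : x ∈ e.baseSet) (w : F) : MDiffAt (T% (fun y ↦ e.symmL 𝕜 y w)) x :=
  (contMDiffAt_symmL_apply (n := 1) hx w).mdifferentiableAt one_ne_zero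

end VectorBundle

section RiemannianBundle

variable {E : Type*} [NormedAddCommGroup E] [NormedSpace ℝ E]
  {H : Type*} [TopologicalSpace H] {I : ModelWithCorners ℝ E H}
  {M : Type*} [TopologicalSpace M] [ChartedSpace H M]
  {F : Type*} [NormedAddCommGroup F] [NormedSpace ℝ F] [FiniteDimensional ℝ F]
  {V : M → Type*} [TopologicalSpace (TotalSpace F V)] [∀ x, NormedAddCommGroup (V x)]
  [∀ x, InnerProductSpace ℝ (V x)] [FiberBundle F V] [VectorBundle ℝ F V]
  {e : Trivialization F (TotalSpace.proj : TotalSpace F V → M)} [MemTrivializationAtlas e]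

variable (e) in
/-- The metric of a Riemannian vector bundle at `y`, as a bilinear form on the model fibre by
means of the trivialization `e`; it is degenerate outside `e.baseSet`. -/
def metricInTrivialization (y : M) : F →L[ℝ] F →L[ℝ] ℝ :=
  (innerSL ℝ).bilinearComp (e.symmL ℝ y) (e.symmL ℝ y)

theorem isInvertible_metricInTrivialization {y : M} (hy : y ∈ e.baseSet) :
    (metricInTrivialization e y).IsInvertible := by
  have hinj : Function.Injective (metricInTrivialization e y).toLinearMap := by
    refine (injective_iff_map_eq_zero _).2 fun v hv ↦ ?_
    have hv' : e.symmL ℝ y v = 0 := by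
      simpa [metricInTrivialization] using congr($hv v)
    rw [← trivialization_symmL_apply_snd (𝕜 := ℝ) hy v, hv']
    exact (e.linear ℝ hy).map_zero
  have hdim : Module.finrank ℝ F = Module.finrank ℝ (F →L[ℝ] ℝ) :=
    Subspace.dual_finrank_eq.symm.trans LinearMap.toContinuousLinearMap.finrank_eq
  exact ⟨(LinearMap.linearEquivOfInjective _ hinj hdim).toContinuousLinearEquiv, rfl⟩

theorem contMDiffAt_section_of_inner_symmL {n : ℕ∞ω} [ContMDiffVectorBundle n F V I]
    [IsContMDiffRiemannianBundle I n F V] {s : Π y, V y} {x : M} (hx : x ∈ e.baseSet)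
    (hs : ∀ w, CMDiffAt n (fun y ↦ inner ℝ (s y) (e.symmL ℝ y w)) x) : CMDiffAt n (T% s) x := by
  have hG : CMDiffAt n (metricInTrivialization e) x :=
    contMDiffAt_clm_of_forall_apply fun v ↦ contMDiffAt_clm_of_forall_apply fun w ↦
      ContMDiffAt.inner_bundle (b := fun y ↦ y) (contMDiffAt_symmL_apply hx v)
        (contMDiffAt_symmL_apply hx w)
  have hκ : CMDiffAt n (fun y ↦ (innerSL ℝ (s y)).comp (e.symmL ℝ y)) x :=
    contMDiffAt_clm_of_forall_apply hs
  have hinv : CMDiffAt n (fun y ↦ (metricInTrivialization e y).inverse) x :=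
    (isInvertible_metricInTrivialization hx).contDiffAt_map_inverse.contMDiffAt.comp x hG
  refine (e.contMDiffAt_section_iff hx).2 <| (hinv.clm_apply hκ).congr_of_eventuallyEq ?_
  filter_upwards [e.open_baseSet.mem_nhds hx] with y hy
  refine ((isInvertible_metricInTrivialization hy).inverse_apply_eq.2 ?_).symm
  ext w
  simp [metricInTrivialization, symmL_trivialization_apply_snd (𝕜 := ℝ) hy]

end RiemannianBundle

section AlongCurve

variable {E : Type*} [NormedAddCommGroup E] [NormedSpace ℝ E]
  {H : Type*} [TopologicalSpace H] {I : ModelWithCorners ℝ E H}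
  {M : Type*} [TopologicalSpace M] [ChartedSpace H M]
  {F : Type*} [NormedAddCommGroup F] [NormedSpace ℝ F]
  {G : Type*} [NormedAddCommGroup G] [NormedSpace ℝ G]
  {γ : ℝ → M} {J : Set ℝ} {t : ℝ}

theorem hasDerivWithinAt_comp_curve {g : M → F} (hg : MDiffAt g (γ t))
    (hγ : MDifferentiableWithinAt 𝓘(ℝ, ℝ) I γ J t) :
    HasDerivWithinAt (fun s ↦ g (γ s)) (d% g (γ t) (velocity I γ J t)) J t :=
  HasFDerivWithinAt.hasDerivWithinAt (f' := d% g (γ t) ∘L mfderivWithin 𝓘(ℝ, ℝ) I γ J t)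
    (hg.hasMFDerivAt.comp_hasMFDerivWithinAt t hγ.hasMFDerivWithinAt).hasFDerivWithinAt

theorem hasDerivWithinAt_clm_apply_curve {A : M → F →L[ℝ] G} {v : ℝ → F} {v' : F}
    (hA : MDiffAt A (γ t)) (hγ : MDifferentiableWithinAt 𝓘(ℝ, ℝ) I γ J t)
    (hv : HasDerivWithinAt v v' J t) :
    HasDerivWithinAt (fun s ↦ A (γ s) (v s))
      (d% (fun y ↦ A y (v t)) (γ t) (velocity I γ J t) + A (γ t) v') J t := by
  have hAv : d% (fun y ↦ A y (v t)) (γ t) =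
      ContinuousLinearMap.apply ℝ G (v t) ∘L d% A (γ t) :=
    mfderiv_comp (γ t) (ContinuousLinearMap.apply ℝ G (v t)).mdifferentiableAt hA |>.trans <| by
      rw [ContinuousLinearMap.mfderiv_eq]; rfl
  rw [hAv]
  exact (hasDerivWithinAt_comp_curve hA hγ).clm_apply hv

end AlongCurve

theorem contMDiffAt_mvfderiv_apply {𝕜 : Type*} [NontriviallyNormedField 𝕜]
    {E : Type*} [NormedAddCommGroup E] [NormedSpace 𝕜 E]
    {H : Type*} [TopologicalSpace H] {I : ModelWithCorners 𝕜 E H}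
    {M : Type*} [TopologicalSpace M] [ChartedSpace H M] {m n : ℕ∞ω} [IsManifold I 1 M]
    {F : Type*} [NormedAddCommGroup F] [NormedSpace 𝕜 F] {g : M → F}
    {X : Π x : M, TangentSpace I x} {x : M}
    (hg : CMDiffAt n g x) (hX : CMDiffAt m (T% X) x) (hmn : m + 1 ≤ n) :
    CMDiffAt m (fun y ↦ d% g y (X y)) x := by
  have h := ContMDiffAt.clm_apply_of_inCoordinates (ϕ := fun y ↦ mfderiv I 𝓘(𝕜, F) g y)
    (hg.mfderiv_const hmn) hX (hg.of_le (le_self_add.trans hmn))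
  simpa using! (contMDiffAt_totalSpace.1 h).2

section CovariantDerivative

variable {E : Type*} [NormedAddCommGroup E] [NormedSpace ℝ E] [FiniteDimensional ℝ E]
  {H : Type*} [TopologicalSpace H] {I : ModelWithCorners ℝ E H}
  {M : Type*} [TopologicalSpace M] [ChartedSpace H M] [IsManifold I ∞ M]
  {γ : ℝ → M} {J : Set ℝ} {t : ℝ} {V : Π t : ℝ, TangentSpace I (γ t)}
  {e : Trivialization E (TotalSpace.proj : TangentBundle I M → M)} [MemTrivializationAtlas e]
  {v' : E}

theorem covDerivAlong_eq_of_hasDerivWithinAt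
    (cov : CovariantDerivative I E (TangentSpace I : M → Type _)) (hJ : UniqueDiffWithinAt ℝ J t)
    (hγ : MDifferentiableWithinAt 𝓘(ℝ, ℝ) I γ J t) (he : γ t ∈ e.baseSet)
    (hv : HasDerivWithinAt (fun s ↦ (e ⟨γ s, V s⟩).2) v' J t) :
    covDerivAlong cov γ J V t = e.symmL ℝ (γ t) v' +
      cov (fun y ↦ e.symmL ℝ y (e ⟨γ t, V t⟩).2) (γ t) (velocity I γ J t) := by
  let e₀ := trivializationAt E (TangentSpace I : M → Type _) (γ t)
  set v : ℝ → E := fun s ↦ (e ⟨γ s, V s⟩).2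
  let A (y : M) : E →L[ℝ] E := e.coordChangeL ℝ e₀ y
  have ht₀ : γ t ∈ e₀.baseSet := FiberBundle.mem_baseSet_trivializationAt' (γ t)
  have hA : MDiffAt A (γ t) :=
    (contMDiffAt_coordChangeL (n := 1) he ht₀).mdifferentiableAt one_ne_zero
  have hA_apply {y : M} (hy : y ∈ e.baseSet) (hy₀ : y ∈ e₀.baseSet) (w : E) :
      A y w = (e₀ ⟨y, e.symmL ℝ y w⟩).2 := by
    rw [e.symmL_apply hy]
    exact e.coordChangeL_apply e₀ ⟨hy, hy₀⟩ w
  have hAv {s : ℝ} (hs : γ s ∈ e.baseSet) (hs₀ : γ s ∈ e₀.baseSet) :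
      (e₀ ⟨γ s, V s⟩).2 = A (γ s) (v s) := by
    rw [hA_apply hs hs₀, symmL_trivialization_apply_snd (𝕜 := ℝ) hs]
  have hderiv : derivWithin (fun s ↦ (e₀ ⟨γ s, V s⟩).2) J t =
      d% (fun y ↦ A y (v t)) (γ t) (velocity I γ J t) + A (γ t) v' := by
    refine ((hasDerivWithinAt_clm_apply_curve hA hγ hv).congr_of_eventuallyEq ?_
      (hAv he ht₀)).derivWithin hJ
    filter_upwards [hγ.continuousWithinAt (e.open_baseSet.mem_nhds he),
      hγ.continuousWithinAt (e₀.open_baseSet.mem_nhds ht₀)] with s using hAv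
  have hd : d% (fun y ↦ (e₀ ⟨y, e.symmL ℝ y (v t)⟩).2) (γ t) = d% (fun y ↦ A y (v t)) (γ t) := by
    refine Filter.EventuallyEq.mfderiv_eq ?_
    filter_upwards [e.open_baseSet.mem_nhds he, e₀.open_baseSet.mem_nhds ht₀] with y hy hy₀
      using (hA_apply hy hy₀ (v t)).symm
  have hcov : cov (fun y ↦ e.symmL ℝ y (v t)) (γ t) (velocity I γ J t) =
      e₀.symmL ℝ (γ t) (d% (fun y ↦ A y (v t)) (γ t) (velocity I γ J t)) +
        cov (extend E (V t)) (γ t) (velocity I γ J t) := by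
    rw [cov_eq_trivialization cov (mdifferentiableAt_symmL_apply he (v t)), hd,
      symmL_trivialization_apply_snd (𝕜 := ℝ) he]
  rw [covDerivAlong, hderiv, hcov, map_add, hA_apply he ht₀,
    symmL_trivialization_apply_snd (𝕜 := ℝ) ht₀]
  abel

theorem hasDerivWithinAt_mvfderiv_apply_curve
    (cov : CovariantDerivative I E (TangentSpace I : M → Type _)) (f : C^∞⟮I, M; 𝓘(ℝ, ℝ), ℝ⟯)
    (hJ : UniqueDiffWithinAt ℝ J t) (hγ : MDifferentiableWithinAt 𝓘(ℝ, ℝ) I γ J t)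
    (he : γ t ∈ e.baseSet) (hv : HasDerivWithinAt (fun s ↦ (e ⟨γ s, V s⟩).2) v' J t) :
    HasDerivWithinAt (fun s ↦ d% f (γ s) (V s))
      (hessian cov f (γ t) (velocity I γ J t) (V t) +
        d% f (γ t) (covDerivAlong cov γ J V t)) J t := by
  let Y (y : M) : TangentSpace I y := e.symmL ℝ y (e ⟨γ t, V t⟩).2
  let A (y : M) : E →L[ℝ] ℝ := d% f y ∘L e.symmL ℝ y
  have hA : MDiffAt A (γ t) := by
    refine (contMDiffAt_clm_of_forall_apply (n := 1) fun w ↦ ?_).mdifferentiableAt one_ne_zero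
    exact contMDiffAt_mvfderiv_apply f.contMDiff.contMDiffAt (contMDiffAt_symmL_apply he w)
      (by decide)
  have hAV {s : ℝ} (hs : γ s ∈ e.baseSet) :
      d% f (γ s) (V s) = A (γ s) (e ⟨γ s, V s⟩).2 :=
    congr_arg (d% f (γ s)) (symmL_trivialization_apply_snd (𝕜 := ℝ) hs (V s)).symm
  have hhess : hessian cov f (γ t) (velocity I γ J t) (V t) +
      d% f (γ t) (cov Y (γ t) (velocity I γ J t)) =
        d% (fun y ↦ d% f y (Y y)) (γ t) (velocity I γ J t) := by
    have h := hessian_apply cov f (mdifferentiableAt_extend I E (velocity I γ J t))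
      (mdifferentiableAt_symmL_apply he (e ⟨γ t, V t⟩).2)
    rw [extend_apply_self, symmL_trivialization_apply_snd (𝕜 := ℝ) he] at h
    exact eq_sub_iff_add_eq.1 h
  rw [covDerivAlong_eq_of_hasDerivWithinAt cov hJ hγ he hv, map_add, add_comm (d% f (γ t) _),
    ← add_assoc, hhess]
  exact (hasDerivWithinAt_clm_apply_curve hA hγ hv).congr_of_eventuallyEq
    (Filter.Eventually.mono (hγ.continuousWithinAt (e.open_baseSet.mem_nhds he)) fun _ ↦ hAV)
    (hAV he)

end CovariantDerivative

theorem uniqueDiffOn_of_ordConnected {J : Set ℝ} (hJ : J.OrdConnected) (hJ' : J.Nontrivial) :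
    UniqueDiffOn ℝ J :=
  uniqueDiffOn_convex hJ.convex (hJ.convex.nontrivial_iff_nonempty_interior.1 hJ')

theorem exists_affine_of_hasDerivWithinAt_of_hasDerivWithinAt_zero {F : Type*}
    [NormedAddCommGroup F] [NormedSpace ℝ F] {u u' : ℝ → F} {J : Set ℝ} (hJ : J.OrdConnected)
    (hu : ∀ t ∈ J, HasDerivWithinAt u (u' t) J t) (hu' : ∀ t ∈ J, HasDerivWithinAt u' 0 J t) :
    ∃ a b : F, ∀ t ∈ J, u t = t • a + b := by
  have hconst {v : ℝ → F} (hv : ∀ t ∈ J, HasDerivWithinAt v 0 J t) {s t : ℝ} (hs : s ∈ J)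
      (ht : t ∈ J) : v t = v s := by
    have h := hJ.convex.norm_image_sub_le_of_norm_hasDerivWithin_le (C := 0) hv
      (fun _ _ ↦ norm_zero.le) hs ht
    rwa [zero_mul, norm_le_zero_iff, sub_eq_zero] at h
  obtain rfl | ⟨s, hs⟩ := J.eq_empty_or_nonempty
  · exact ⟨0, 0, by simp⟩
  refine ⟨u' s, u s - s • u' s, fun t ht ↦ ?_⟩
  have h := hconst (v := fun r ↦ u r - r • u' s) (fun r hr ↦ ?_) hs ht
  · rwa [sub_eq_iff_eq_add'] at h
  · simpa [hconst hu' hs hr] using (hu r hr).fun_sub ((hasDerivWithinAt_id r J).smul_const (u' s))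

section Autoparallel

variable {E : Type*} [NormedAddCommGroup E] [NormedSpace ℝ E]
  {H : Type*} [TopologicalSpace H] {I : ModelWithCorners ℝ E H}
  {M : Type*} [TopologicalSpace M] [ChartedSpace H M] {γ : ℝ → M} {J : Set ℝ} {t : ℝ}

theorem mdifferentiableWithinAt_velocity [IsManifold I 1 M] (hγ : ContMDiffOn 𝓘(ℝ, ℝ) I 2 γ J)
    (hJ : UniqueDiffOn ℝ J) (ht : t ∈ J) :
    MDifferentiableWithinAt 𝓘(ℝ, ℝ) I.tangent
      (fun s ↦ (⟨γ s, velocity I γ J s⟩ : TangentBundle I M)) J t := by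
  have hT := hγ.contMDiffOn_tangentMapWithin (m := 1) (by norm_num) hJ.uniqueMDiffOn
  have hone : ContMDiff 𝓘(ℝ, ℝ) 𝓘(ℝ, ℝ).tangent 1
      (fun s : ℝ ↦ (⟨s, (1 : ℝ)⟩ : TangentBundle 𝓘(ℝ, ℝ) ℝ)) :=
    contMDiff_vectorSpace_iff_contDiff.2 contDiff_const
  exact ((hT.comp hone.contMDiffOn fun s hs ↦ hs) t ht).mdifferentiableWithinAt one_ne_zero

variable [IsManifold I ∞ M] {cov : CovariantDerivative I E (TangentSpace I : M → Type _)}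

/-- `γ` is a `C^2` curve on `J` whose velocity is parallel along it for the connection `cov`. The
geodesics of a Riemannian manifold are the autoparallel curves of its Levi-Civita connection. -/
structure IsAutoparallelOn (cov : CovariantDerivative I E (TangentSpace I : M → Type _))
    (γ : ℝ → M) (J : Set ℝ) : Prop where
  contMDiffOn : ContMDiffOn 𝓘(ℝ, ℝ) I 2 γ J
  covDerivAlong_velocity : ∀ t ∈ J, covDerivAlong cov γ J (velocity I γ J) t = 0

theorem IsAutoparallelOn.mdifferentiableWithinAt (hγ : IsAutoparallelOn cov γ J) (ht : t ∈ J) :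
    MDifferentiableWithinAt 𝓘(ℝ, ℝ) I γ J t :=
  (hγ.contMDiffOn t ht).mdifferentiableWithinAt two_ne_zero

variable [FiniteDimensional ℝ E] {f : C^∞⟮I, M; 𝓘(ℝ, ℝ), ℝ⟯}

theorem isGeodesicOn_iff_isAutoparallelOn [RiemannianBundle (fun x : M ↦ TangentSpace I x)]
    [IsContMDiffRiemannianBundle I ∞ E (fun x : M ↦ TangentSpace I x)] :
    IsGeodesicOn I γ J ↔ IsAutoparallelOn (leviCivita I M) γ J :=
  ⟨fun h ↦ ⟨h.1, h.2⟩, fun h ↦ ⟨h.1, h.2⟩⟩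

theorem IsAutoparallelOn.hasDerivWithinAt_mvfderiv_velocity (hγ : IsAutoparallelOn cov γ J)
    (hJ : UniqueDiffOn ℝ J) (ht : t ∈ J) :
    HasDerivWithinAt (fun s ↦ d% f (γ s) (velocity I γ J s))
      (hessian cov f (γ t) (velocity I γ J t) (velocity I γ J t)) J t := by
  have hv := ((mdifferentiableWithinAt_totalSpace _ _).1
    (mdifferentiableWithinAt_velocity hγ.contMDiffOn hJ ht)).2.differentiableWithinAt
  have h := hasDerivWithinAt_mvfderiv_apply_curve cov f (hJ t ht) (hγ.mdifferentiableWithinAt ht)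
    (FiberBundle.mem_baseSet_trivializationAt' (γ t)) hv.hasDerivWithinAt
  rwa [hγ.covDerivAlong_velocity t ht, map_zero, add_zero] at h

theorem IsAutoparallelOn.exists_affine_of_hessian_eq_zero (hf : ∀ p, hessian cov f p = 0)
    (hγ : IsAutoparallelOn cov γ J) (hJ : J.OrdConnected) :
    ∃ a b : ℝ, ∀ t ∈ J, f (γ t) = a * t + b := by
  obtain hsub | hJ' := J.subsingleton_or_nontrivial
  · obtain rfl | ⟨t, rfl⟩ := hsub.eq_empty_or_singleton
    · exact ⟨0, 0, by simp⟩
    · exact ⟨0, f (γ t), by simp⟩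
  obtain ⟨a, b, hab⟩ := exists_affine_of_hasDerivWithinAt_of_hasDerivWithinAt_zero hJ
    (fun t ht ↦ hasDerivWithinAt_comp_curve f.mdifferentiableAt (hγ.mdifferentiableWithinAt ht))
    fun t ht ↦ by
      simpa [hf] using hγ.hasDerivWithinAt_mvfderiv_velocity (f := f)
        (uniqueDiffOn_of_ordConnected hJ hJ') ht
  exact ⟨a, b, fun t ht ↦ by rw [hab t ht, smul_eq_mul, mul_comm]⟩

theorem IsAutoparallelOn.hessian_velocity_eq_zero {a b : ℝ} (hγ : IsAutoparallelOn cov γ J)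
    (hJ : UniqueDiffOn ℝ J) (hf : ∀ t ∈ J, f (γ t) = a * t + b) (ht : t ∈ J) :
    hessian cov f (γ t) (velocity I γ J t) (velocity I γ J t) = 0 := by
  have hfirst : ∀ s ∈ J, d% f (γ s) (velocity I γ J s) = a := fun s hs ↦
    (hJ s hs).eq_deriv J
      (hasDerivWithinAt_comp_curve f.mdifferentiableAt (hγ.mdifferentiableWithinAt hs))
      ((((hasDerivWithinAt_id s J).const_mul a).add_const b).congr hf (hf s hs) |>.congr_deriv
        (mul_one a))
  exact (hJ t ht).eq_deriv J (hγ.hasDerivWithinAt_mvfderiv_velocity hJ ht)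
    ((hasDerivWithinAt_const t J a).congr hfirst (hfirst t ht))

end Autoparallel

section Chart

variable {E : Type*} [NormedAddCommGroup E] [NormedSpace ℝ E]
  {H : Type*} [TopologicalSpace H] {I : ModelWithCorners ℝ E H}
  {M : Type*} [TopologicalSpace M] [ChartedSpace H M]
  {F : Type*} [NormedAddCommGroup F] [NormedSpace ℝ F] {g : M → F} {p q : M}

theorem mfderivWithin_extChartAt_symm [IsManifold I 1 M] {z : E}
    (hz : z ∈ (extChartAt I p).target) :
    mfderivWithin 𝓘(ℝ, E) I (extChartAt I p).symm (Set.range I) z =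
      (trivializationAt E (TangentSpace I : M → Type _) p).symmL ℝ ((extChartAt I p).symm z) := by
  have hq := (extChartAt I p).map_target hz
  rw [TangentBundle.symmL_trivializationAt (by rwa [← extChartAt_source I]),
    (extChartAt I p).right_inv hz]

theorem mvfderiv_symmL_trivializationAt [IsManifold I 1 M] (hq : q ∈ (extChartAt I p).source)
    (hg : MDiffAt g q) (w : E) :
    d% g q ((trivializationAt E (TangentSpace I : M → Type _) p).symmL ℝ q w) =
      fderivWithin ℝ (g ∘ (extChartAt I p).symm) (Set.range I) (extChartAt I p q) w := by
  have hz := (extChartAt I p).map_source hq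
  rw [← (extChartAt I p).left_inv hq] at hg
  have h := mfderiv_comp_mfderivWithin _ hg (mdifferentiableWithinAt_extChartAt_symm hz)
    (I.uniqueDiffOn _ (extChartAt_target_subset_range p hz)).uniqueMDiffWithinAt
  rw [mfderivWithin_eq_fderivWithin, mfderivWithin_extChartAt_symm hz,
    (extChartAt I p).left_inv hq] at h
  exact congr($h.symm w)

theorem mvfderiv_mvfderiv_symmL_trivializationAt [IsManifold I 2 M] (hg : CMDiffAt 2 g p)
    (v w : E) :
    letI e := trivializationAt E (TangentSpace I : M → Type _) p
    d% (fun y ↦ d% g y (e.symmL ℝ y w)) p (e.symmL ℝ p v) =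
      fderivWithin ℝ (fderivWithin ℝ (g ∘ (extChartAt I p).symm) (Set.range I)) (Set.range I)
        (extChartAt I p p) v w := by
  have : IsManifold I 1 M := .of_le one_le_two
  have : IsManifold I (1 + 1) M := by rwa [one_add_one_eq_two]
  set φ := extChartAt I p
  let e := trivializationAt E (TangentSpace I : M → Type _) p
  have hp : p ∈ φ.source := mem_extChartAt_source p
  have hφp : φ p ∈ Set.range I := Set.mem_range_self _
  have hDg : MDiffAt (fun y ↦ d% g y (e.symmL ℝ y w)) p :=
    (contMDiffAt_mvfderiv_apply (m := 1) hg (contMDiffAt_symmL_apply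
      (FiberBundle.mem_baseSet_trivializationAt' p) w) one_add_one_eq_two.le).mdifferentiableAt
        one_ne_zero
  have hg' : ∀ᶠ z in nhdsWithin (φ p) (Set.range I), MDiffAt g (φ.symm z) := by
    have hφ : Filter.Tendsto φ.symm (nhdsWithin (φ p) (Set.range I)) (nhds p) :=
      (map_extChartAt_symm_nhdsWithin_range p).le
    exact (hφ.eventually ((contMDiffAt_iff_contMDiffAt_nhds (by decide)).1 hg)).mono
      fun _ h ↦ h.mdifferentiableAt two_ne_zero
  have hfirst : (fun y ↦ d% g y (e.symmL ℝ y w)) ∘ φ.symm =ᶠ[nhdsWithin (φ p) (Set.range I)]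
      fun z ↦ fderivWithin ℝ (g ∘ φ.symm) (Set.range I) z w := by
    filter_upwards [extChartAt_target_mem_nhdsWithin p, hg'] with z hz hgz
    exact (mvfderiv_symmL_trivializationAt (φ.map_target hz) hgz w).trans
      (by rw [φ.right_inv hz])
  have hsecond : DifferentiableWithinAt ℝ (fderivWithin ℝ (g ∘ φ.symm) (Set.range I))
      (Set.range I) (φ p) :=
    ((contMDiffAt_iff.1 hg).2.fderivWithin_right I.uniqueDiffOn one_add_one_eq_two.le
      hφp).differentiableWithinAt one_ne_zero
  rw [mvfderiv_symmL_trivializationAt hp hDg, hfirst.fderivWithin_eq_of_mem hφp,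
    fderivWithin_clm_apply (I.uniqueDiffOn _ hφp) hsecond (differentiableWithinAt_const _)]
  simp

theorem mlieBracket_symmL_trivializationAt [IsManifold I 1 M] (v w : E) :
    letI e := trivializationAt E (TangentSpace I : M → Type _) p
    mlieBracket I (fun y ↦ e.symmL ℝ y v) (fun y ↦ e.symmL ℝ y w) p = 0 := by
  set φ := extChartAt I p
  have hconst (u : E) : mpullbackWithin 𝓘(ℝ, E) I φ.symm
      (fun y ↦ (trivializationAt E (TangentSpace I : M → Type _) p).symmL ℝ y u) (Set.range I)
        =ᶠ[nhdsWithin (φ p) (Set.range I)] fun _ ↦ u := by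
    filter_upwards [extChartAt_target_mem_nhdsWithin p] with z hz
    refine (isInvertible_mfderivWithin_extChartAt_symm hz).inverse_apply_eq.2 ?_
    exact congr($((mfderivWithin_extChartAt_symm hz).symm) u)
  have hφp : φ p ∈ Set.range I := Set.mem_range_self _
  rw [mlieBracket, mlieBracketWithin_apply, Set.preimage_univ, Set.univ_inter,
    (hconst v).lieBracketWithin_vectorField_eq ((hconst v).self_of_nhdsWithin hφp) (hconst w)
      ((hconst w).self_of_nhdsWithin hφp)]
  simp only [lieBracketWithin, fderivWithin_fun_const, Pi.zero_apply, _root_.zero_apply, sub_self]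
  exact map_zero _

end Chart

section Symmetry

variable {E : Type*} [NormedAddCommGroup E] [NormedSpace ℝ E] [FiniteDimensional ℝ E]
  {H : Type*} [TopologicalSpace H] {I : ModelWithCorners ℝ E H}
  {M : Type*} [TopologicalSpace M] [ChartedSpace H M] [IsManifold I ∞ M]
  {cov : CovariantDerivative I E (TangentSpace I : M → Type _)}

theorem hessian_symm (hcov : cov.torsion = 0) (f : C^∞⟮I, M; 𝓘(ℝ, ℝ), ℝ⟯) {p : M}
    (v w : TangentSpace I p) : hessian cov f p v w = hessian cov f p w v := by
  set e := trivializationAt E (TangentSpace I : M → Type _) p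
  have hp : p ∈ e.baseSet := FiberBundle.mem_baseSet_trivializationAt' p
  have hf : CMDiffAt 2 f p := f.contMDiff.contMDiffAt.of_le (by decide)
  suffices h : ∀ v w : E, hessian cov f p (e.symmL ℝ p v) (e.symmL ℝ p w) =
      hessian cov f p (e.symmL ℝ p w) (e.symmL ℝ p v) by
    simpa only [symmL_trivialization_apply_snd (𝕜 := ℝ) hp] using h (e ⟨p, v⟩).2 (e ⟨p, w⟩).2
  intro v w
  have hv := mdifferentiableAt_symmL_apply (𝕜 := ℝ) (I := I) hp v
  have hw := mdifferentiableAt_symmL_apply (𝕜 := ℝ) (I := I) hp w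
  have htorsion := (CovariantDerivative.torsion_eq_zero_iff cov).1 hcov hv hw
  rw [mlieBracket_symmL_trivializationAt, sub_eq_zero] at htorsion
  rw [hessian_apply cov f hv hw, hessian_apply cov f hw hv, htorsion,
    mvfderiv_mvfderiv_symmL_trivializationAt hf, mvfderiv_mvfderiv_symmL_trivializationAt hf]
  congr 1
  exact (contMDiffAt_iff.1 hf).2.isSymmSndFDerivWithinAt (by simp)
    I.uniqueDiffOn (I.range_subset_closure_interior (Set.mem_range_self _))
    (Set.mem_range_self _) v w

end Symmetry

section Regularity

variable {E : Type*} [NormedAddCommGroup E] [NormedSpace ℝ E]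
  {H : Type*} [TopologicalSpace H] {I : ModelWithCorners ℝ E H}
  {M : Type*} [TopologicalSpace M] [ChartedSpace H M] [IsManifold I ∞ M]

/-- The connection `cov` is of class `C^n`: `∇_X Y` is `C^n` wherever `X` and `Y` are `C^(n+1)`. In
a chart this says that the Christoffel symbols are `C^n`. Unlike Mathlib's
`ContMDiffCovariantDerivative`, this is a condition on local rather than global sections. -/
def IsContMDiffConnection (cov : CovariantDerivative I E (TangentSpace I : M → Type _))
    (n : ℕ∞ω) : Prop :=
  ∀ ⦃X Y : Π x : M, TangentSpace I x⦄ ⦃x : M⦄, CMDiffAt (n + 1) (T% X) x →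
    CMDiffAt (n + 1) (T% Y) x → CMDiffAt n (T% (fun y ↦ cov Y y (X y))) x

variable {n : ℕ∞} {X Y Z : Π x : M, TangentSpace I x} {x : M}

theorem contMDiffAt_mlieBracket [CompleteSpace E] (hX : CMDiffAt (n + 1) (T% X) x)
    (hY : CMDiffAt (n + 1) (T% Y) x) : CMDiffAt n (T% (mlieBracket I X Y)) x := by
  have hle (m : ℕ∞) : (m : ℕ∞ω) ≤ ∞ := by exact_mod_cast le_top
  have : IsManifold I ((n + 1 : ℕ∞) + 1) M := .of_le (hle (n + 1 + 1))
  have : IsManifold I (minSmoothness ℝ 2) M := .of_le (n := ∞) (by simpa using hle 2)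
  have : IsManifold I (minSmoothness ℝ 3) M := .of_le (n := ∞) (by simpa using hle 3)
  exact ContMDiffAt.mlieBracket_vectorField (m := n) (n := n + 1) hX hY (by simp)

variable [RiemannianBundle (fun x : M ↦ TangentSpace I x)]
  [IsContMDiffRiemannianBundle I ∞ E (fun x : M ↦ TangentSpace I x)]

theorem contMDiffAt_inner (hX : CMDiffAt n (T% X) x) (hY : CMDiffAt n (T% Y) x) :
    CMDiffAt n (fun y ↦ inner ℝ (X y) (Y y)) x := by
  have : IsContMDiffRiemannianBundle I n E (fun x : M ↦ TangentSpace I x) :=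
    .of_le (n := ∞) (by exact_mod_cast le_top)
  exact ContMDiffAt.inner_bundle (b := fun y ↦ y) hX hY

theorem contMDiffAt_koszul [CompleteSpace E] (hX : CMDiffAt (n + 1) (T% X) x)
    (hY : CMDiffAt (n + 1) (T% Y) x) (hZ : CMDiffAt (n + 1) (T% Z) x) :
    CMDiffAt n (koszul X Y Z) x := by
  have hderiv {U V W : Π x : M, TangentSpace I x} (hU : CMDiffAt (n + 1) (T% U) x)
      (hV : CMDiffAt (n + 1) (T% V) x) (hW : CMDiffAt (n + 1) (T% W) x) :
      CMDiffAt n (fun y ↦ d% (fun z ↦ inner ℝ (U z) (V z)) y (W y)) x :=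
    contMDiffAt_mvfderiv_apply (contMDiffAt_inner (n := n + 1) hU hV)
      (hW.of_le le_self_add) le_rfl
  have hbracket {U V W : Π x : M, TangentSpace I x} (hU : CMDiffAt (n + 1) (T% U) x)
      (hV : CMDiffAt (n + 1) (T% V) x) (hW : CMDiffAt (n + 1) (T% W) x) :
      CMDiffAt n (fun y ↦ inner ℝ (mlieBracket I U V y) (W y)) x :=
    contMDiffAt_inner (contMDiffAt_mlieBracket hU hV) (hW.of_le le_self_add)
  exact contMDiffAt_const.mul (((((hderiv hY hZ hX).add (hderiv hX hZ hY)).sub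
    (hderiv hX hY hZ)).add (hbracket hX hY hZ)).sub (hbracket hX hZ hY) |>.sub (hbracket hY hZ hX))

theorem isContMDiffConnection_leviCivita [FiniteDimensional ℝ E] :
    IsContMDiffConnection (leviCivita I M) n := by
  intro X Y x hX hY
  let e := trivializationAt E (TangentSpace I : M → Type _) x
  have hx : x ∈ e.baseSet := FiberBundle.mem_baseSet_trivializationAt' x
  have : IsContMDiffRiemannianBundle I n E (fun x : M ↦ TangentSpace I x) :=
    .of_le (n := ∞) (by exact_mod_cast le_top)
  have : ContMDiffVectorBundle (n + 1) E (TangentSpace I : M → Type _) I :=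
    .of_le (n := ∞) (by exact_mod_cast le_top)
  have := FiniteDimensional.complete ℝ E
  refine contMDiffAt_section_of_inner_symmL (V := fun y : M ↦ TangentSpace I y) (e := e) hx
    fun w ↦ ?_
  have hw : CMDiffAt (n + 1) (T% (fun y ↦ e.symmL ℝ y w)) x := contMDiffAt_symmL_apply hx w
  refine (contMDiffAt_koszul hX hY hw).congr_of_eventuallyEq ?_
  have hdiff {Z : Π x : M, TangentSpace I x} (hZ : CMDiffAt (n + 1) (T% Z) x) :
      ∀ᶠ y in nhds x, MDiffAt (T% Z) y :=
    ((contMDiffAt_iff_contMDiffAt_nhds (by decide)).1 (hZ.of_le le_add_self)).mono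
      fun _ h ↦ h.mdifferentiableAt one_ne_zero
  filter_upwards [hdiff hX, hdiff hY, hdiff hw] with y hXy hYy hwy
    using inner_leviCivitaFun hXy hYy hwy

end Regularity

theorem contDiffOn_succ_of_hasDerivAt {𝕜 F : Type*} [NontriviallyNormedField 𝕜]
    [NormedAddCommGroup F] [NormedSpace 𝕜 F] {n : ℕ∞ω} (hn : n ≠ ω) {x v : 𝕜 → F} {J : Set 𝕜}
    (hJ : IsOpen J) (hx : ∀ t ∈ J, HasDerivAt x (v t) t) (hv : ContDiffOn 𝕜 n v J) :
    ContDiffOn 𝕜 (n + 1) x J :=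
  (contDiffOn_succ_iff_deriv_of_isOpen hJ).2
    ⟨fun t ht ↦ (hx t ht).differentiableAt.differentiableWithinAt, fun h ↦ absurd h hn,
      hv.congr fun t ht ↦ (hx t ht).deriv⟩

section AutoparallelExistence

variable {E : Type*} [NormedAddCommGroup E] [NormedSpace ℝ E]
  {H : Type*} [TopologicalSpace H] {I : ModelWithCorners ℝ E H}
  {M : Type*} [TopologicalSpace M] [ChartedSpace H M] {p : M} {z : E}

theorem extChartAt_symm_mem_baseSet [IsManifold I 1 M] (hz : z ∈ (extChartAt I p).target) :
    (extChartAt I p).symm z ∈ (trivializationAt E (TangentSpace I : M → Type _) p).baseSet := by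
  rw [TangentBundle.trivializationAt_baseSet, ← extChartAt_source I]
  exact (extChartAt I p).map_target hz

theorem velocity_extChartAt_symm_comp [IsManifold I 1 M] {x : ℝ → E} {v : E} {J : Set ℝ} {t : ℝ}
    (hJ : UniqueDiffWithinAt ℝ J t) (hx : ∀ s ∈ J, x s ∈ (extChartAt I p).target) (ht : t ∈ J)
    (hv : HasDerivWithinAt x v J t) :
    velocity I (fun s ↦ (extChartAt I p).symm (x s)) J t =
      (trivializationAt E (TangentSpace I : M → Type _) p).symmL ℝ
        ((extChartAt I p).symm (x t)) v := by
  have h := mfderivWithin_comp t (mdifferentiableWithinAt_extChartAt_symm (hx t ht))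
    hv.differentiableWithinAt.mdifferentiableWithinAt
    (fun s hs ↦ extChartAt_target_subset_range p (hx s hs)) hJ.uniqueMDiffWithinAt
  rw [mfderivWithin_extChartAt_symm (hx t ht), mfderivWithin_eq_fderivWithin] at h
  refine congr($h (1 : ℝ)).trans ?_
  exact congrArg _ (hv.derivWithin hJ)

variable [IsManifold I ∞ M] {cov : CovariantDerivative I E (TangentSpace I : M → Type _)}

/-- The Christoffel symbols of `cov` in the preferred chart at `p`, as a bilinear map: in the
coordinate frame `(e_i)` of that chart, `christoffel cov p z v w` is the coordinate vector of
`∑ v^i w^j ∇_{e_i} e_j` at the point of coordinates `z`. -/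
def christoffel (cov : CovariantDerivative I E (TangentSpace I : M → Type _)) (p : M)
    (z v w : E) : E :=
  letI e := trivializationAt E (TangentSpace I : M → Type _) p
  letI y := (extChartAt I p).symm z
  (e ⟨y, cov (fun q ↦ e.symmL ℝ q w) y (e.symmL ℝ y v)⟩).2

theorem symmL_christoffel (hz : z ∈ (extChartAt I p).target) (v w : E) :
    letI e := trivializationAt E (TangentSpace I : M → Type _) p
    letI y := (extChartAt I p).symm z
    e.symmL ℝ y (christoffel cov p z v w) = cov (fun q ↦ e.symmL ℝ q w) y (e.symmL ℝ y v) :=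
  symmL_trivialization_apply_snd (extChartAt_symm_mem_baseSet hz) _

theorem isLinearMap_christoffel_left (hz : z ∈ (extChartAt I p).target) (w : E) :
    IsLinearMap ℝ fun v ↦ christoffel cov p z v w := by
  have he := (trivializationAt E (TangentSpace I : M → Type _) p).linear ℝ
    (extChartAt_symm_mem_baseSet hz)
  constructor
  · intro v v'
    simp only [christoffel, map_add]
    exact he.map_add _ _
  · intro c v
    simp only [christoffel, map_smul]
    exact he.map_smul _ _

theorem isLinearMap_christoffel_right (hz : z ∈ (extChartAt I p).target) (v : E) :
    IsLinearMap ℝ fun w ↦ christoffel cov p z v w := by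
  let e := trivializationAt E (TangentSpace I : M → Type _) p
  let y := (extChartAt I p).symm z
  have hy : y ∈ e.baseSet := extChartAt_symm_mem_baseSet hz
  have hdiff (w : E) := mdifferentiableAt_symmL_apply (𝕜 := ℝ) (I := I) hy w
  constructor
  · intro w w'
    have h : cov (fun q ↦ e.symmL ℝ q (w + w')) y =
        cov (fun q ↦ e.symmL ℝ q w) y + cov (fun q ↦ e.symmL ℝ q w') y := by
      simp only [map_add]
      exact cov.isCovariantDerivativeOnUniv.add (hdiff w) (hdiff w')
    simp only [christoffel, e, y] at h ⊢
    rw [h]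
    exact (e.linear ℝ hy).map_add _ _
  · intro c w
    have h : cov (fun q ↦ e.symmL ℝ q (c • w)) y = c • cov (fun q ↦ e.symmL ℝ q w) y := by
      simp only [map_smul]
      exact cov.isCovariantDerivativeOnUniv.smul_const c (hdiff w)
    simp only [christoffel, e, y] at h ⊢
    rw [h]
    exact (e.linear ℝ hy).map_smul _ _

theorem contDiffAt_christoffel {n : ℕ∞} (hcov : IsContMDiffConnection cov n)
    (hz : z ∈ interior (extChartAt I p).target) (v w : E) :
    ContDiffAt ℝ n (fun u ↦ christoffel cov p u v w) z := by
  have hle (m : ℕ∞) : (m : ℕ∞ω) ≤ ∞ := by exact_mod_cast le_top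
  have : ContMDiffVectorBundle (n + 1) E (TangentSpace I : M → Type _) I :=
    .of_le (hle (n + 1))
  have : IsManifold I n M := .of_le (hle n)
  have hy := extChartAt_symm_mem_baseSet (interior_subset hz)
  have hchart : ContMDiffAt 𝓘(ℝ, E) I n (extChartAt I p).symm z :=
    (contMDiffOn_extChartAt_symm p).contMDiffAt (mem_interior_iff_mem_nhds.1 hz)
  have hsection := hcov (contMDiffAt_symmL_apply hy v) (contMDiffAt_symmL_apply hy w)
  exact (((Trivialization.contMDiffAt_section_iff _ hy).1 hsection).comp z hchart).contDiffAt

variable [FiniteDimensional ℝ E]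

theorem contDiffAt_christoffel_self {n : ℕ∞} (hcov : IsContMDiffConnection cov n)
    (hz : z ∈ interior (extChartAt I p).target) (v : E) :
    ContDiffAt ℝ n (fun u : E × E ↦ christoffel cov p u.1 u.2 u.2) (z, v) := by
  have htarget : ∀ᶠ u in nhds z, u ∈ (extChartAt I p).target := mem_interior_iff_mem_nhds.1 hz
  have hright (v' : E) : ContDiffAt ℝ n (fun u : E × E ↦ christoffel cov p u.1 v' u.2) (z, v) :=
    contDiffAt_uncurry_of_isLinearMap
      (htarget.mono fun _ hu ↦ isLinearMap_christoffel_right hu v')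
      (contDiffAt_christoffel hcov hz v') v
  have hleft : ∀ᶠ u : E × E in nhds (z, v), IsLinearMap ℝ fun v' ↦ christoffel cov p u.1 v' u.2 :=
    (continuousAt_fst.eventually htarget).mono fun u hu ↦ isLinearMap_christoffel_left hu u.2
  have hboth : ContDiffAt ℝ n (fun u : (E × E) × E ↦ christoffel cov p u.1.1 u.2 u.1.2)
      ((z, v), v) :=
    contDiffAt_uncurry_of_isLinearMap hleft hright v
  exact hboth.comp (f := fun u : E × E ↦ (u, u.2)) (z, v) (contDiffAt_id.prodMk contDiffAt_snd)

theorem isAutoparallelOn_extChartAt_symm_comp {n : ℕ∞} (hcov : IsContMDiffConnection cov n)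
    {x v : ℝ → E} {J : Set ℝ} (hJ : IsOpen J)
    (hxJ : ∀ t ∈ J, x t ∈ interior (extChartAt I p).target)
    (hx : ∀ t ∈ J, HasDerivAt x (v t) t)
    (hv : ∀ t ∈ J, HasDerivAt v (-christoffel cov p (x t) (v t) (v t)) t) :
    IsAutoparallelOn cov (fun s ↦ (extChartAt I p).symm (x s)) J := by
  let e := trivializationAt E (TangentSpace I : M → Type _) p
  have hxt (t) (ht : t ∈ J) : x t ∈ (extChartAt I p).target := interior_subset (hxJ t ht)
  have hacc : ContinuousOn (fun t ↦ -christoffel cov p (x t) (v t) (v t)) J := fun t ht ↦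
    ((contDiffAt_christoffel_self hcov (hxJ t ht) (v t)).continuousAt.comp
      (f := fun t ↦ (x t, v t))
      ((hx t ht).continuousAt.prodMk (hv t ht).continuousAt)).neg.continuousWithinAt
  have hx₂ : ContDiffOn ℝ (0 + 1 + 1) x J :=
    contDiffOn_succ_of_hasDerivAt (by decide) hJ hx
      (contDiffOn_succ_of_hasDerivAt (by decide) hJ hv (contDiffOn_zero.2 hacc))
  rw [zero_add, one_add_one_eq_two] at hx₂
  have hγ : ContMDiffOn 𝓘(ℝ, ℝ) I 2 (fun s ↦ (extChartAt I p).symm (x s)) J :=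
    (contMDiffOn_extChartAt_symm p).comp hx₂.contMDiffOn hxt
  refine ⟨hγ, fun t ht ↦ ?_⟩
  have hvelocity (s) (hs : s ∈ J) := velocity_extChartAt_symm_comp (hJ.uniqueDiffWithinAt hs) hxt hs
    (hx s hs).hasDerivWithinAt
  have hcoord (s) (hs : s ∈ J) : (e ⟨(extChartAt I p).symm (x s),
      velocity I (fun s ↦ (extChartAt I p).symm (x s)) J s⟩).2 = v s := by
    rw [hvelocity s hs]
    exact trivialization_symmL_apply_snd (extChartAt_symm_mem_baseSet (hxt s hs)) (v s)
  rw [covDerivAlong_eq_of_hasDerivWithinAt cov (hJ.uniqueDiffWithinAt ht)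
    ((hγ t ht).mdifferentiableWithinAt two_ne_zero) (extChartAt_symm_mem_baseSet (hxt t ht))
    ((hv t ht).hasDerivWithinAt.congr hcoord (hcoord t ht)), hcoord t ht, hvelocity t ht, map_neg,
    symmL_christoffel (hxt t ht), neg_add_cancel]

theorem exists_isAutoparallelOn (hcov : IsContMDiffConnection cov 1)
    (hz : z ∈ interior (extChartAt I p).target) (v : E) :
    letI e := trivializationAt E (TangentSpace I : M → Type _) p
    letI y := (extChartAt I p).symm z
    ∃ ε > 0, ∃ γ : ℝ → M, IsAutoparallelOn cov γ (Set.Ioo (-ε) ε) ∧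
      (⟨γ 0, velocity I γ (Set.Ioo (-ε) ε) 0⟩ : TangentBundle I M) = ⟨y, e.symmL ℝ y v⟩ := by
  have := FiniteDimensional.complete ℝ E
  obtain ⟨α, hα₀, ε, hε, hα⟩ :=
    (contDiffAt_snd.prodMk (contDiffAt_christoffel_self (n := 1) hcov hz v).neg
      |>.exists_forall_mem_closedBall_exists_eq_forall_mem_Ioo_hasDerivAt₀ 0)
  have hinterior : ∀ᶠ t in nhds 0, (α t).1 ∈ interior (extChartAt I p).target :=
    (continuousAt_fst.comp (hα 0 (by simpa using hε)).continuousAt)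
      (isOpen_interior.mem_nhds (by simpa [hα₀] using hz))
  obtain ⟨δ, hδ, hballδ⟩ := Metric.eventually_nhds_iff.1 hinterior
  let r := min ε δ
  have hr : 0 < r := lt_min hε hδ
  have h₀ : (0 : ℝ) ∈ Set.Ioo (-r) r := by simpa using hr
  have hαr (t) (ht : t ∈ Set.Ioo (-r) r) := hα t
    ⟨by linarith [ht.1, min_le_left ε δ], by linarith [ht.2, min_le_left ε δ]⟩
  have hderiv (t) (ht : t ∈ Set.Ioo (-r) r) : HasDerivAt (fun s ↦ (α s).1) (α t).2 t :=
    (hαr t ht).fst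
  have hαint (t) (ht : t ∈ Set.Ioo (-r) r) : (α t).1 ∈ interior (extChartAt I p).target :=
    hballδ (by simpa using (abs_lt.2 ht).trans_le (min_le_right ε δ))
  refine ⟨r, hr, fun t ↦ (extChartAt I p).symm (α t).1,
    isAutoparallelOn_extChartAt_symm_comp (n := 1) hcov isOpen_Ioo hαint
      hderiv fun t ht ↦ (hαr t ht).snd, ?_⟩
  rw [velocity_extChartAt_symm_comp (isOpen_Ioo.uniqueDiffWithinAt h₀)
    (fun t ht ↦ interior_subset (hαint t ht)) h₀ (hderiv 0 h₀).hasDerivWithinAt]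
  beta_reduce
  rw [hα₀]

end AutoparallelExistence

section HessianVanishing

variable {E : Type*} [NormedAddCommGroup E] [NormedSpace ℝ E]
  {H : Type*} [TopologicalSpace H] {I : ModelWithCorners ℝ E H}
  {M : Type*} [TopologicalSpace M] [ChartedSpace H M]

theorem frequently_mem_interior_extChartAt_target (p : M) :
    ∃ᶠ z in nhds (extChartAt I p p), z ∈ interior (extChartAt I p).target := by
  have hrange : ∃ᶠ z in nhds (extChartAt I p p), z ∈ interior (Set.range I) :=
    mem_closure_iff_frequently.1 (I.range_subset_closure_interior (Set.mem_range_self _))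
  have htarget := (eventually_nhdsWithin_iff.1
    (extChartAt_target_mem_nhdsWithin (I := I) p)).eventually_nhds
  refine (hrange.and_eventually htarget).mono fun z ⟨hz, hz'⟩ ↦ ?_
  rw [mem_interior_iff_mem_nhds] at hz ⊢
  filter_upwards [hz, hz'] with w hw hw' using hw' hw

variable [FiniteDimensional ℝ E] [IsManifold I ∞ M]
  {cov : CovariantDerivative I E (TangentSpace I : M → Type _)} {f : C^∞⟮I, M; 𝓘(ℝ, ℝ), ℝ⟯}

theorem continuousAt_hessian (hcov : IsContMDiffConnection cov 1) (f : C^∞⟮I, M; 𝓘(ℝ, ℝ), ℝ⟯)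
    {X Y : Π x : M, TangentSpace I x} {x : M} (hX : CMDiffAt 2 (T% X) x)
    (hY : CMDiffAt 2 (T% Y) x) :
    ContinuousAt (fun y ↦ hessian cov f y (X y) (Y y)) x := by
  have hfx : CMDiffAt 2 f x := f.contMDiff.contMDiffAt.of_le (by decide)
  have hYf : CMDiffAt 1 (fun y ↦ d% f y (Y y)) x :=
    contMDiffAt_mvfderiv_apply hfx (hY.of_le one_le_two) one_add_one_eq_two.le
  have hXYf : CMDiffAt 0 (fun y ↦ d% (fun y ↦ d% f y (Y y)) y (X y)) x :=
    contMDiffAt_mvfderiv_apply hYf (hX.of_le zero_le_two) (zero_add 1).le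
  have hcovf : CMDiffAt 1 (fun y ↦ d% f y (cov Y y (X y))) x :=
    contMDiffAt_mvfderiv_apply hfx
      (hcov (hX.of_le one_add_one_eq_two.le) (hY.of_le one_add_one_eq_two.le))
      one_add_one_eq_two.le
  refine (hXYf.continuousAt.sub hcovf.continuousAt).congr ?_
  filter_upwards [(contMDiffAt_iff_contMDiffAt_nhds (by decide)).1 hX,
    (contMDiffAt_iff_contMDiffAt_nhds (by decide)).1 hY] with y hXy hYy
  exact (hessian_apply cov f (hXy.mdifferentiableAt (by decide))
    (hYy.mdifferentiableAt (by decide))).symm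

theorem hessian_eq_zero_of_mem_interior (htorsion : cov.torsion = 0)
    (hcov : IsContMDiffConnection cov 1)
    (hf : ∀ (J : Set ℝ) (γ : ℝ → M), J.OrdConnected → IsAutoparallelOn cov γ J →
      ∃ a b : ℝ, ∀ t ∈ J, f (γ t) = a * t + b)
    {p : M} {z : E} (hz : z ∈ interior (extChartAt I p).target) :
    hessian cov f ((extChartAt I p).symm z) = 0 := by
  let y := (extChartAt I p).symm z
  let e := trivializationAt E (TangentSpace I : M → Type _) p
  have hdiag (w : TangentSpace I y) : hessian cov f y w w = 0 := by
    obtain ⟨ε, hε, γ, hγ, hγ₀⟩ := exists_isAutoparallelOn hcov hz (e ⟨y, w⟩).2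
    rw [symmL_trivialization_apply_snd (𝕜 := ℝ)
      (extChartAt_symm_mem_baseSet (interior_subset hz)) w] at hγ₀
    obtain ⟨a, b, hab⟩ := hf _ γ Set.ordConnected_Ioo hγ
    let Q (u : TangentBundle I M) : ℝ := hessian cov f u.1 u.2 u.2
    exact (congrArg Q hγ₀).symm.trans <|
      hγ.hessian_velocity_eq_zero isOpen_Ioo.uniqueDiffOn hab (by simpa using hε)
  ext v w
  have hpolar := hdiag (v + w)
  have hsymm : hessian cov f y v w = hessian cov f y w v := hessian_symm htorsion f v w
  simp only [map_add, _root_.add_apply, hdiag] at hpolar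
  change hessian cov f y v w = 0
  linarith

theorem hessian_eq_zero_of_forall_affine (htorsion : cov.torsion = 0)
    (hcov : IsContMDiffConnection cov 1)
    (hf : ∀ (J : Set ℝ) (γ : ℝ → M), J.OrdConnected → IsAutoparallelOn cov γ J →
      ∃ a b : ℝ, ∀ t ∈ J, f (γ t) = a * t + b) (p : M) :
    hessian cov f p = 0 := by
  let e := trivializationAt E (TangentSpace I : M → Type _) p
  have hp : p ∈ e.baseSet := FiberBundle.mem_baseSet_trivializationAt' p
  have hfreq : ∃ᶠ y in nhds p, hessian cov f y = 0 := by
    have h := (continuousAt_extChartAt_symm (I := I) p).tendsto.frequently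
      (p := fun y ↦ hessian cov f y = 0) <|
      (frequently_mem_interior_extChartAt_target p).mono fun z hz ↦
        hessian_eq_zero_of_mem_interior htorsion hcov hf hz
    rwa [extChartAt_to_inv] at h
  have : ContMDiffVectorBundle 2 E (TangentSpace I : M → Type _) I := .of_le (n := ∞) (by decide)
  have hsymmL (v w : E) : hessian cov f p (e.symmL ℝ p v) (e.symmL ℝ p w) = 0 := by
    by_contra hne
    have hcont := continuousAt_hessian hcov f (X := fun y ↦ e.symmL ℝ y v)
      (Y := fun y ↦ e.symmL ℝ y w) (contMDiffAt_symmL_apply hp v) (contMDiffAt_symmL_apply hp w)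
    obtain ⟨y, hy, hy'⟩ := (hfreq.and_eventually (hcont.eventually_ne hne)).exists
    exact hy' (by rw [hy, _root_.zero_apply, _root_.zero_apply])
  ext v w
  simpa only [_root_.zero_apply, symmL_trivialization_apply_snd hp]
    using hsymmL (e ⟨p, v⟩).2 (e ⟨p, w⟩).2

end HessianVanishing

end RiemannianHessian

end

theorem proposition1_general
    {E : Type*} [NormedAddCommGroup E] [NormedSpace ℝ E] [FiniteDimensional ℝ E]
    {H : Type*} [TopologicalSpace H] {I : ModelWithCorners ℝ E H}
    {M : Type*} [TopologicalSpace M] [ChartedSpace H M] [IsManifold I ∞ M]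
    {cov : CovariantDerivative I E (TangentSpace I : M → Type _)} (htorsion : cov.torsion = 0)
    (hcov : RiemannianHessian.IsContMDiffConnection cov 1) (f : C^∞⟮I, M; 𝓘(ℝ, ℝ), ℝ⟯) :
    (∀ p : M, RiemannianHessian.hessian cov f p = 0) ↔
      ∀ (J : Set ℝ) (γ : ℝ → M), J.OrdConnected → RiemannianHessian.IsAutoparallelOn cov γ J →
        ∃ a b : ℝ, ∀ t ∈ J, f (γ t) = a * t + b :=
  ⟨fun hf _ _ hJ hγ ↦ hγ.exists_affine_of_hessian_eq_zero hf hJ,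
    RiemannianHessian.hessian_eq_zero_of_forall_affine htorsion hcov⟩

theorem proposition1
    {E : Type*} [NormedAddCommGroup E] [NormedSpace ℝ E] [FiniteDimensional ℝ E]
    {H : Type*} [TopologicalSpace H] {I : ModelWithCorners ℝ E H}
    {M : Type*} [TopologicalSpace M] [ChartedSpace H M] [IsManifold I ∞ M]
    [RiemannianBundle (fun x : M ↦ TangentSpace I x)]
    [IsContMDiffRiemannianBundle I ∞ E (fun x : M ↦ TangentSpace I x)]
    (f : C^∞⟮I, M; 𝓘(ℝ, ℝ), ℝ⟯) :
    (∀ p : M, RiemannianHessian.hessian (RiemannianHessian.leviCivita I M) f p = 0) ↔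
      ∀ (J : Set ℝ) (γ : ℝ → M), J.OrdConnected → RiemannianHessian.IsGeodesicOn I γ J →
        ∃ a b : ℝ, ∀ t ∈ J, f (γ t) = a * t + b := by
  simpa only [RiemannianHessian.isGeodesicOn_iff_isAutoparallelOn] using
    proposition1_general RiemannianHessian.leviCivita_torsion
      (RiemannianHessian.isContMDiffConnection_leviCivita (n := 1)) f
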